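/- Fix $d$, a vector $\beta\in\mathbb R^d$ and a positive definite $d\times d$ matrix $\Sigma$. A continuous knockoff procedure is given by a continuous map $\Delta(\cdot)$ that sends each positive definite matrix $S$ to a diagonal matrix $\Delta(S)\succeq S$, and by continuous functions $W_1^+,\dots,W_d^+:\mathbb R^d\times\mathbb R^d\to[0,\infty)$. Put $W_j^-(\xi,\tilde\beta)=W_j^+(\xi,\mathrm{flip}_j\tilde\beta)$, where $\mathrm{flip}_j$ changes the sign of the $j$-th coordinate, and $W_j=\max\{W_j^+,W_j^-\}\,\mathrm{sgn}(W_j^+-W_j^-)$. For $b,\omega\in\mathbb R^d$, a positive definite $S$ and $\alpha\in\mathbb R$, let $\tilde\beta=b+\omega$, $\xi=S^{-1}b-\Delta(S)^{-1}\tilde\beta$, and let $\mathcal R_\alpha(b,S;\omega)=\{j: W_j\ge\hat t\}$ with $W_j=W_j(\xi,\tilde\beta)$, where $\hat t$ is the smallest $t\in\{|W_1|,\dots,|W_d|\}\setminus\{0\}$ with $\frac{1+\#\{j:\,W_j\le -t\}}{\#\{j:\,W_j\ge t\}}\le\alpha$ (a ratio with denominator $0$ being $+\infty$; if there is no such $t$,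 nothing is rejected). If $S$ is not positive definite, put $\mathcal R_\alpha(b,S;\omega)=\emptyset$. For each $n$ let $\hat\beta_n$ be a random vector in $\mathbb R^d$ and $\hat\Sigma_n$ a random symmetric $d\times d$ matrix, such that $\hat\beta_n\Rightarrow\mathcal N_d(\beta,\Sigma)$ and $\hat\Sigma_n\to\Sigma$ in probability. Let $\omega_n=(\Delta(\hat\Sigma_n)-\hat\Sigma_n)^{1/2}\omega_n'$ (positive semidefinite square root; defined whenever $\hat\Sigma_n$ is positive definite), where $\omega_n'\sim\mathcal N_d(0,I_d)$ is independent of $(\hat\beta_n,\hat\Sigma_n)$. Let $\hat\beta\sim\mathcal N_d(\beta,\Sigma)$ and $\omega\sim\mathcal N_d(0,\Delta(\Sigma)-\Sigma)$ be independent. Let $E$ be the set of $(\xi,\tilde\beta)\in\mathbb R^d\times\mathbb R^d$ at which the $2d$ numbers $W_1^+,W_1^-,\dots,W_d^+,W_d^-$ are all positive and distinct. Let $V\subseteq\mathbb R^d$ be the range of $\Sigma^{-1}-\Delta(\Sigma)^{-1}$, so that $V=\mathbb R^d$ if $\Delta(\Sigma)-\Sigma$ is nonsingular. Assume that $E^{\mathsf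 c}\cap(V\times\mathbb R^d)$ has Lebesgue measure zero in $V\times\mathbb R^d$ (for nonsingular $\Delta(\Sigma)-\Sigma$: that $E^{\mathsf c}$ has Lebesgue measure zero). Then for every $\alpha\in\mathbb R$ $$\mathcal R_\alpha(\hat\beta_n,\hat\Sigma_n;\omega_n)\;\Rightarrow\;\mathcal R_\alpha(\hat\beta,\Sigma;\omega).$$ Moreover, for the hypotheses $H_j:\beta_j=0$, the false discovery rate $\mathbb E\big[\#\{j\in\mathcal R:\beta_j=0\}/\max\{\#\mathcal R,1\}\big]$ of $\mathcal R=\mathcal R_\alpha(\hat\beta_n,\hat\Sigma_n;\omega_n)$ and, if $\beta\neq0$, its true positive rate $\mathbb E\big[\#\{j\in\mathcal R:\beta_j\ne0\}\big]/\#\{j:\beta_j\ne0\}$ converge to the corresponding quantities for $\mathcal R=\mathcal R_\alpha(\hat\beta,\Sigma;\omega)$. -/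

import Mathlib

open MeasureTheory ProbabilityTheory Filter Topology

namespace Knockoff

/-- Column vectors in `ℝ^d`. -/
abbrev Vec (d : ℕ) := EuclideanSpace ℝ (Fin d)

/-- Real `d × d` matrices. -/
abbrev Mat (d : ℕ) := Matrix (Fin d) (Fin d) ℝ

section Sqrt
open scoped MatrixOrder

/-- The symmetric positive semidefinite square root of a positive semidefinite matrix. -/
noncomputable def psdSqrt {d : ℕ} (S : Mat d) : Mat d := CFC.sqrt S

end Sqrt

/-- Matrix-vector product in `ℝ^d`. -/
noncomputable def mulV {d : ℕ} (S : Mat d) (x : Vec d) : Vec d := Matrix.toEuclideanLin S x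

/-- `flip j b` changes the sign of the `j`-th coordinate of `b`. -/
noncomputable def flip {d : ℕ} (j : Fin d) (b : Vec d) : Vec d :=
  WithLp.toLp 2 (Function.update (fun i => b i) j (-(b j)))

/-- Lebesgue measure of a linear subspace `V` (normalized by orthonormal bases of `V`), regarded as
a measure on `ℝ^d` that is carried by `V`. For `V = ℝ^d` it is Lebesgue measure. -/
noncomputable def subspaceVolume {d : ℕ} (V : Submodule ℝ (Vec d)) : Measure (Vec d) :=
  ((stdOrthonormalBasis ℝ V).toBasis.addHaar).map (fun v : V => (v : Vec d))

/-! ### Selective SeqStep (knockoff+) applied to `W`-statistics -/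

/-- The estimated false discovery proportion `(1 + #{j : W j ≤ -t}) / #{j : W j ≥ t}` at the
threshold `t` is at most `α`, a ratio with denominator `0` being `+∞`. -/
def FdpHatLE {d : ℕ} (α : ℝ) (W : Fin d → ℝ) (t : ℝ) : Prop :=
  1 + ((Finset.univ.filter (fun j => W j ≤ -t)).card : ℝ)
    ≤ α * ((Finset.univ.filter (fun j => t ≤ W j)).card : ℝ)

open Classical in
/-- The knockoff+ threshold: the least `t` among the nonzero `|W j|` whose estimated false
discovery proportion is at most `α`, and `⊤` if there is none. -/
noncomputable def threshold {d : ℕ} (α : ℝ) (W : Fin d → ℝ) : WithTop ℝ :=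
  ((Finset.univ.image (fun j => |W j|)).filter (fun t => 0 < t ∧ FdpHatLE α W t)).min

open Classical in
/-- The hypotheses rejected at level `α` on the basis of the statistics `W`. -/
noncomputable def seqStep {d : ℕ} (α : ℝ) (W : Fin d → ℝ) : Finset (Fin d) :=
  Finset.univ.filter (fun j => threshold α W ≤ (W j : WithTop ℝ))

/-! ### Knockoff procedures in the whitening form -/

/-- The two ingredients of a knockoff procedure in whitening form: the choice `Δ S`
(its diagonal is listed) of a diagonal matrix dominating the covariance matrix `S`, and the
nonnegative statistics `Wplus ξ b`. The values of `Δ` off the positive definite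
matrices are never used. -/
structure Procedure (d : ℕ) where
  Δ : Mat d → Fin d → ℝ
  Wplus : Vec d → Vec d → Fin d → ℝ
  dominates : ∀ S : Mat d, S.PosDef → (Matrix.diagonal (Δ S) - S).PosSemidef
  Wplus_nonneg : ∀ ξ b j, 0 ≤ Wplus ξ b j

namespace Procedure

variable {d : ℕ} (K : Procedure d)

/-- The matrix `Δ(S)`. -/
def D (S : Mat d) : Mat d := Matrix.diagonal (K.Δ S)

/-- `Δ` (on positive definite matrices) and `Wplus` are continuous. -/
def IsContinuous : Prop :=
  ContinuousOn K.Δ {S : Mat d | S.PosDef} ∧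
    Continuous (fun p : Vec d × Vec d => K.Wplus p.1 p.2)

/-- `W_j^-(ξ, b) = W_j^+(ξ, flip_j b)`. -/
noncomputable def Wminus (ξ b : Vec d) (j : Fin d) : ℝ := K.Wplus ξ (flip j b) j

/-- `W_j = max(W_j^+, W_j^-) * sgn(W_j^+ - W_j^-)`. -/
noncomputable def W (ξ b : Vec d) (j : Fin d) : ℝ :=
  max (K.Wplus ξ b j) (K.Wminus ξ b j) * Real.sign (K.Wplus ξ b j - K.Wminus ξ b j)

/-- The set on which the `2d` numbers `W_j^+, W_j^-` are all positive and distinct. -/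
def goodSet : Set (Vec d × Vec d) :=
  {p | (∀ j, 0 < K.Wplus p.1 p.2 j) ∧ (∀ j, 0 < K.Wminus p.1 p.2 j) ∧
    Function.Injective (Sum.elim (K.Wplus p.1 p.2) (K.Wminus p.1 p.2))}

/-- The whitened estimator. -/
noncomputable def whitened (b ω : Vec d) : Vec d := b + ω

/-- The exploratory statistic `ξ = S⁻¹ b - Δ(S)⁻¹ (b + ω)`. -/
noncomputable def xi (b : Vec d) (S : Mat d) (ω : Vec d) : Vec d :=
  mulV S⁻¹ b - mulV (K.D S)⁻¹ (whitened b ω)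

/-- The factor `(Δ(S) - S)^{1/2}` that turns standard normal noise into whitening noise. -/
noncomputable def M (S : Mat d) : Mat d := psdSqrt (K.D S - S)

open Classical in
/-- The rejection set `R_α(b, S; ω)` of the procedure run on the estimate `b` with covariance matrix
`S` and whitening noise `ω`. If `S` is not positive definite, the procedure
cannot be run and nothing is rejected. -/
noncomputable def rejectionSet (α : ℝ) (b : Vec d) (S : Mat d) (ω : Vec d) : Finset (Fin d) :=
  if S.PosDef then seqStep α (K.W (K.xi b S ω) (whitened b ω)) else ∅

/-- The linear span of the values of `ξ - E ξ` under exact Gaussian sampling with covariance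
matrix `S`: the range of `Cov ξ = S⁻¹ - Δ(S)⁻¹`, which is all of `ℝ^d` if and only if
`Δ(S) - S` is nonsingular. (It contains `E ξ` as well.) -/
noncomputable def xiSpace (S : Mat d) : Submodule ℝ (Vec d) :=
  LinearMap.range (Matrix.toEuclideanLin (S⁻¹ - (K.D S)⁻¹))

/-- If `Δ(S) - S` is nonsingular, a set is null for the Lebesgue measure of `xiSpace S` times
Lebesgue measure exactly when it is Lebesgue-null in `ℝ^d × ℝ^d`: the two measures agree. -/
theorem subspaceVolume_xiSpace (S : Mat d) (hS : S.PosDef) (h : (K.D S - S).PosDef) :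
    (subspaceVolume (K.xiSpace S)).prod volume = (volume : Measure (Vec d × Vec d)) := by
  have hD : (K.D S).PosDef := by simpa using h.add hS
  have e1 : IsUnit (K.D S).det := hD.isUnit.map Matrix.detMonoidHom
  have e2 : IsUnit S.det := hS.isUnit.map Matrix.detMonoidHom
  have e3 : S⁻¹ - (K.D S)⁻¹ = (K.D S)⁻¹ * (K.D S - S) * S⁻¹ := by
    rw [mul_sub, sub_mul, Matrix.nonsing_inv_mul _ e1, Matrix.mul_assoc,
      Matrix.mul_nonsing_inv _ e2]
    simp
  have u : IsUnit (S⁻¹ - (K.D S)⁻¹) := by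
    rw [e3]
    exact (hD.inv.isUnit.mul h.isUnit).mul hS.inv.isUnit
  have top : K.xiSpace S = ⊤ := by
    rw [xiSpace, LinearMap.range_eq_top]
    intro y
    obtain ⟨v, hv⟩ := u
    refine ⟨Matrix.toEuclideanLin (↑v⁻¹ : Mat d) y, ?_⟩
    rw [← hv]
    ext i
    simp [Matrix.toLpLin_apply, Matrix.mulVec_mulVec]
  have vol : subspaceVolume (⊤ : Submodule ℝ (Vec d)) = volume :=
    (LinearIsometryEquiv.ofTop (Vec d) (⊤ : Submodule ℝ (Vec d)) rfl).measurePreserving.map_eq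
  rw [top, vol]
  rfl

end Procedure

/-! ### Error rates, convergence -/

open Classical in
/-- False discovery proportion `V / max(R, 1)` of the rejection set `R`, for `H_j : β_j = 0`. -/
noncomputable def fdp {d : ℕ} (β : Vec d) (R : Finset (Fin d)) : ℝ :=
  ((R.filter (fun j => β j = 0)).card : ℝ) / max (R.card : ℝ) 1

open Classical in
/-- True positive proportion: the fraction of the nonzero `β_j` that is discovered. -/
noncomputable def tpp {d : ℕ} (β : Vec d) (R : Finset (Fin d)) : ℝ :=
  ((R.filter (fun j => β j ≠ 0)).card : ℝ)
    / ((Finset.univ.filter (fun j => β j ≠ 0)).card : ℝ)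

/-- The finite set of possible rejection sets carries the discrete topology. -/
instance instTopologicalSpaceFinset (d : ℕ) : TopologicalSpace (Finset (Fin d)) := ⊥

instance instDiscreteTopologyFinset (d : ℕ) : DiscreteTopology (Finset (Fin d)) := ⟨rfl⟩

/-- Convergence in probability of random matrices (entry by entry) to a constant matrix; the
probability space may depend on `n`. -/
def TendstoInProbability {d : ℕ} {Ω : ℕ → Type*} [∀ n, MeasurableSpace (Ω n)]
    (P : ∀ n, Measure (Ω n)) (X : ∀ n, Ω n → Mat d) (S : Mat d) : Prop :=
  ∀ i j, ∀ ε : ℝ, 0 < ε →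
    Tendsto (fun n => P n {o | ε ≤ |X n o i j - S i j|}) atTop (𝓝 0)

end Knockoff

namespace Knockoff

/-! ### The selective SeqStep procedure -/

section SeqStep

variable {d : ℕ}

theorem mem_seqStep_iff {α : ℝ} {W : Fin d → ℝ} {j : Fin d} :
    j ∈ seqStep α W ↔ ∃ k, 0 < |W k| ∧ FdpHatLE α W |W k| ∧ |W k| ≤ W j := by
  classical
  unfold seqStep threshold
  rw [Finset.mem_filter]
  simp only [Finset.mem_univ, true_and]
  constructor
  · intro h
    obtain ⟨t, ht⟩ := WithTop.ne_top_iff_exists.1 (h.trans_lt (WithTop.coe_lt_top _)).ne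
    have hm := Finset.mem_of_min ht.symm
    simp only [Finset.mem_filter, Finset.mem_image, Finset.mem_univ, true_and] at hm
    obtain ⟨⟨k, rfl⟩, h0, h1⟩ := hm
    refine ⟨k, h0, by convert h1, ?_⟩
    rw [← ht] at h
    exact WithTop.coe_le_coe.1 h
  · rintro ⟨k, h0, h1, h2⟩
    refine (Finset.min_le (a := |W k|) ?_).trans (WithTop.coe_le_coe.2 h2)
    simp only [Finset.mem_filter, Finset.mem_image, Finset.mem_univ, true_and]
    exact ⟨⟨k, rfl⟩, h0, by convert h1⟩

/-- The rejection set depends only on the signs of the statistics and the order of their absolute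
values. -/
theorem seqStep_congr {α : ℝ} {W W' : Fin d → ℝ} (hneg : ∀ j, W j < 0 ↔ W' j < 0)
    (hpos : ∀ j, 0 < W j ↔ 0 < W' j) (habs : ∀ j k, |W j| ≤ |W k| ↔ |W' j| ≤ |W' k|) :
    seqStep α W = seqStep α W' := by
  have h0 : ∀ k, 0 < |W k| ↔ 0 < |W' k| := fun k => by
    rw [abs_pos, abs_pos, ne_iff_lt_or_gt, ne_iff_lt_or_gt, hneg, hpos]
  have key : ∀ (V : Fin d → ℝ) j k, 0 < |V k| →
      ((|V k| ≤ V j ↔ 0 < V j ∧ |V k| ≤ |V j|) ∧ (V j ≤ -|V k| ↔ V j < 0 ∧ |V k| ≤ |V j|)) := by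
    intro V j k hk
    constructor
    · constructor
      · exact fun h => ⟨hk.trans_le h, h.trans (le_abs_self _)⟩
      · rintro ⟨h, h'⟩
        rwa [abs_of_pos h] at h'
    · constructor
      · exact fun h => ⟨by linarith, by linarith [neg_le_abs (V j)]⟩
      · rintro ⟨h, h'⟩
        rw [abs_of_neg h] at h'
        linarith
  ext j
  rw [mem_seqStep_iff, mem_seqStep_iff]
  refine exists_congr fun k => ?_
  rw [← h0 k]
  refine and_congr_right fun hk => ?_
  have hk' := (h0 k).1 hk
  refine and_congr ?_ ?_
  · have e1 : ∀ i, W i ≤ -|W k| ↔ W' i ≤ -|W' k| := fun i => by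
      rw [(key W i k hk).2, (key W' i k hk').2, hneg, habs]
    have e2 : ∀ i, |W k| ≤ W i ↔ |W' k| ≤ W' i := fun i => by
      rw [(key W i k hk).1, (key W' i k hk').1, hpos, habs]
    simp only [FdpHatLE, e1, e2]
  · rw [(key W j k hk).1, (key W' j k hk').1, hpos, habs]

theorem measurable_seqStep (α : ℝ) : Measurable (fun W : Fin d → ℝ => seqStep α W) := by
  rw [measurable_finset_iff]
  intro j
  simp only [mem_seqStep_iff]
  refine Measurable.exists fun k => ?_
  have h1 : ∀ i, MeasurableSet {W : Fin d → ℝ | W i ≤ -|W k|} := fun i =>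
    measurableSet_le (measurable_pi_apply i) (by fun_prop)
  have h2 : ∀ i, MeasurableSet {W : Fin d → ℝ | |W k| ≤ W i} := fun i =>
    measurableSet_le (by fun_prop) (measurable_pi_apply i)
  have h3 : MeasurableSet {W : Fin d → ℝ | FdpHatLE α W |W k|} := by
    simp only [FdpHatLE, Finset.card_filter, Nat.cast_sum, Nat.cast_ite, Nat.cast_one,
      Nat.cast_zero]
    refine measurableSet_le ?_ ?_
    · exact measurable_const.add (Finset.measurable_sum _ fun i _ =>
        Measurable.ite (h1 i) measurable_const measurable_const)
    · exact measurable_const.mul (Finset.measurable_sum _ fun i _ =>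
        Measurable.ite (h2 i) measurable_const measurable_const)
  have h4 : MeasurableSet {W : Fin d → ℝ | 0 < |W k|} :=
    measurableSet_lt measurable_const (by fun_prop)
  exact (measurableSet_setOfPred.1 h4).and
    ((measurableSet_setOfPred.1 h3).and (measurableSet_setOfPred.1 (h2 j)))

/-- The rejection set computed from the pair `(W⁺, W⁻)`. -/
noncomputable def seqStepPair (α : ℝ) (p : (Fin d → ℝ) × (Fin d → ℝ)) : Finset (Fin d) :=
  seqStep α (fun j => max (p.1 j) (p.2 j) * Real.sign (p.1 j - p.2 j))

theorem measurable_sign : Measurable Real.sign := by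
  unfold Real.sign
  exact Measurable.ite measurableSet_Iio measurable_const
    (Measurable.ite measurableSet_Ioi measurable_const measurable_const)

theorem measurable_seqStepPair (α : ℝ) : Measurable (seqStepPair (d := d) α) := by
  refine (measurable_seqStep α).comp (measurable_pi_lambda _ fun j => ?_)
  have h1 : Measurable fun p : (Fin d → ℝ) × (Fin d → ℝ) => p.1 j := by fun_prop
  have h2 : Measurable fun p : (Fin d → ℝ) × (Fin d → ℝ) => p.2 j := by fun_prop
  exact (h1.max h2).mul (measurable_sign.comp (h1.sub h2))

theorem max_mul_sign_of_lt {a b : ℝ} (h : a < b) : max a b * Real.sign (a - b) = -b := by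
  rw [Real.sign_of_neg (sub_neg.2 h), max_eq_right h.le, mul_neg_one]

theorem max_mul_sign_of_gt {a b : ℝ} (h : b < a) : max a b * Real.sign (a - b) = a := by
  rw [Real.sign_of_pos (sub_pos.2 h), max_eq_left h.le, mul_one]

theorem abs_max_mul_sign {a b : ℝ} (ha : 0 < a) (hab : a ≠ b) :
    |max a b * Real.sign (a - b)| = max a b := by
  rcases lt_or_gt_of_ne hab with h | h
  · rw [max_mul_sign_of_lt h, abs_neg, abs_of_pos (ha.trans h), max_eq_right h.le]
  · rw [max_mul_sign_of_gt h, abs_of_pos ha, max_eq_left (le_of_lt h)]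

theorem max_mul_sign_neg_iff {a b : ℝ} (ha : 0 < a) : max a b * Real.sign (a - b) < 0 ↔ a < b := by
  rcases lt_trichotomy a b with h | rfl | h
  · rw [max_mul_sign_of_lt h]
    exact iff_of_true (neg_neg_of_pos (ha.trans h)) h
  · simp
  · rw [max_mul_sign_of_gt h]
    exact iff_of_false ha.not_gt h.not_gt

theorem max_mul_sign_pos_iff {a b : ℝ} (ha : 0 < a) : 0 < max a b * Real.sign (a - b) ↔ b < a := by
  rcases lt_trichotomy a b with h | rfl | h
  · rw [max_mul_sign_of_lt h]
    exact iff_of_false (neg_neg_of_pos (ha.trans h)).not_gt h.not_gt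
  · simp
  · rw [max_mul_sign_of_gt h]
    exact iff_of_true ha h

theorem eventually_lt_iff_of_ne {X : Type*} [TopologicalSpace X] {f g : X → ℝ}
    (hf : Continuous f) (hg : Continuous g) {x : X} (h : f x ≠ g x) :
    ∀ᶠ y in 𝓝 x, (f y < g y ↔ f x < g x) ∧ (f y ≤ g y ↔ f x ≤ g x) ∧ f y ≠ g y := by
  rcases lt_or_gt_of_ne h with h | h
  · filter_upwards [(isOpen_lt hf hg).mem_nhds h] with y hy
    exact ⟨iff_of_true hy h, iff_of_true (le_of_lt hy) h.le, ne_of_lt hy⟩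
  · filter_upwards [(isOpen_lt hg hf).mem_nhds h] with y hy
    exact ⟨iff_of_false (lt_asymm hy) h.not_gt, iff_of_false (not_le.2 hy) h.not_ge, ne_of_gt hy⟩

theorem eventually_seqStepPair_eq (α : ℝ) (p : (Fin d → ℝ) × (Fin d → ℝ)) (hp : ∀ j, 0 < p.1 j)
    (hinj : Function.Injective (Sum.elim p.1 p.2)) :
    ∀ᶠ q in 𝓝 p, seqStepPair α q = seqStepPair α p := by
  have c1 : ∀ j, Continuous fun q : (Fin d → ℝ) × (Fin d → ℝ) => q.1 j := fun j => by fun_prop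
  have c2 : ∀ j, Continuous fun q : (Fin d → ℝ) × (Fin d → ℝ) => q.2 j := fun j => by fun_prop
  have ne : ∀ j k, p.1 j ≠ p.2 k := fun j k h =>
    Sum.inl_ne_inr (hinj (a₁ := Sum.inl j) (a₂ := Sum.inr k) h)
  have n1 : ∀ j k, j ≠ k → p.1 j ≠ p.1 k := fun j k hjk h =>
    hjk (Sum.inl_injective (hinj (a₁ := Sum.inl j) (a₂ := Sum.inl k) h))
  have n2 : ∀ j k, j ≠ k → p.2 j ≠ p.2 k := fun j k hjk h =>
    hjk (Sum.inr_injective (hinj (a₁ := Sum.inr j) (a₂ := Sum.inr k) h))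
  have e1 : ∀ᶠ q in 𝓝 p, ∀ j, 0 < q.1 j :=
    eventually_all.2 fun j => (isOpen_lt continuous_const (c1 j)).mem_nhds (hp j)
  have e2 := eventually_all.2 fun j => eventually_lt_iff_of_ne (c1 j) (c2 j) (ne j j)
  have e2' := eventually_all.2 fun j => eventually_lt_iff_of_ne (c2 j) (c1 j) (ne j j).symm
  have e3 : ∀ᶠ q in 𝓝 p, ∀ j k,
      (max (q.1 j) (q.2 j) ≤ max (q.1 k) (q.2 k) ↔ max (p.1 j) (p.2 j) ≤ max (p.1 k) (p.2 k)) := by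
    refine eventually_all.2 fun j => eventually_all.2 fun k => ?_
    rcases eq_or_ne j k with rfl | hjk
    · simp
    · have : max (p.1 j) (p.2 j) ≠ max (p.1 k) (p.2 k) := by
        rcases max_choice (p.1 j) (p.2 j) with h | h <;>
          rcases max_choice (p.1 k) (p.2 k) with h' | h' <;> rw [h, h']
        exacts [n1 _ _ hjk, ne _ _, (ne _ _).symm, n2 _ _ hjk]
      filter_upwards [eventually_lt_iff_of_ne ((c1 j).max (c2 j)) ((c1 k).max (c2 k)) this]
        with q hq using hq.2.1
  filter_upwards [e1, e2, e2', e3] with q h1 h2 h2' h3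
  refine seqStep_congr (fun j => ?_) (fun j => ?_) (fun j k => ?_)
  · rw [max_mul_sign_neg_iff (h1 j), max_mul_sign_neg_iff (hp j)]
    exact (h2 j).1
  · rw [max_mul_sign_pos_iff (h1 j), max_mul_sign_pos_iff (hp j)]
    exact (h2' j).1
  · rw [abs_max_mul_sign (h1 j) (h2 j).2.2, abs_max_mul_sign (h1 k) (h2 k).2.2,
      abs_max_mul_sign (hp j) (ne j j), abs_max_mul_sign (hp k) (ne k k)]
    exact h3 j k

end SeqStep
end Knockoff

namespace Knockoff

/-! ### Gaussian measures and absolute continuity -/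

theorem pi_absolutelyContinuous : ∀ {n : ℕ} {μ ν : Fin n → Measure ℝ} [∀ i, SigmaFinite (μ i)]
    [∀ i, SigmaFinite (ν i)], (∀ i, μ i ≪ ν i) → Measure.pi μ ≪ Measure.pi ν
  | 0, μ, ν, _, _, _ => by rw [Measure.pi_of_empty, Measure.pi_of_empty]
  | n + 1, μ, ν, _, _, h => by
    have hμ := (measurePreserving_piFinSuccAbove μ 0).symm
    have hν := (measurePreserving_piFinSuccAbove ν 0).symm
    rw [← hμ.map_eq, ← hν.map_eq]
    exact ((h 0).prod (pi_absolutelyContinuous fun i => h _)).map hμ.measurable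

theorem stdGaussian_absolutelyContinuous {d : ℕ} : stdGaussian (Vec d) ≪ volume := by
  rw [← map_pi_eq_stdGaussian, ← (PiLp.volume_preserving_toLp (Fin d)).map_eq]
  exact (pi_absolutelyContinuous fun _ => gaussianReal_absolutelyContinuous 0 one_ne_zero).map
    (PiLp.volume_preserving_toLp (Fin d)).measurable

/-- The image of Lebesgue measure under a surjective affine map is absolutely continuous. -/
theorem map_absolutelyContinuous_of_surjective {E F : Type*} [NormedAddCommGroup E]
    [NormedSpace ℝ E] [FiniteDimensional ℝ E] [MeasurableSpace E] [BorelSpace E]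
    [NormedAddCommGroup F] [NormedSpace ℝ F] [FiniteDimensional ℝ F] [MeasurableSpace F]
    [BorelSpace F] {μ : Measure E} [μ.IsAddHaarMeasure] {ν : Measure F} [ν.IsAddHaarMeasure]
    (L : E →ₗ[ℝ] F) (hL : Function.Surjective L) (c : F) :
    μ.map (fun x => c + L x) ≪ ν := by
  obtain ⟨r, -, hr⟩ := L.exists_map_addHaar_eq_smul_addHaar μ ν hL
  have hm : Measurable L := L.continuous_of_finiteDimensional.measurable
  have : μ.map (fun x => c + L x) = (μ.map L).map (fun y => c + y) :=
    (Measure.map_map (measurable_const_add c) hm).symm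
  rw [this, hr, Measure.map_smul, map_add_left_eq_self]
  exact Measure.smul_absolutelyContinuous

theorem mulV_mul {d : ℕ} (A B : Mat d) (x : Vec d) : mulV (A * B) x = mulV A (mulV B x) := by
  ext i
  simp [mulV, Matrix.toLpLin_apply, Matrix.mulVec_mulVec]

open scoped MatrixOrder in
theorem psdSqrt_spec {d : ℕ} {A : Mat d} (hA : A.PosSemidef) :
    (psdSqrt A).conjTranspose = psdSqrt A ∧ psdSqrt A * psdSqrt A = A :=
  ⟨(Matrix.nonneg_iff_posSemidef.1 (CFC.sqrt_nonneg A)).isHermitian,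
    CFC.sqrt_mul_sqrt_self A hA.nonneg⟩

theorem range_psdSqrt {d : ℕ} {A : Mat d} (hA : A.PosSemidef) :
    LinearMap.range (Matrix.toEuclideanLin (psdSqrt A))
      = LinearMap.range (Matrix.toEuclideanLin A) := by
  obtain ⟨h1, h2⟩ := psdSqrt_spec hA
  have h3 := Matrix.toEuclideanLin_conjTranspose_eq_adjoint (psdSqrt A)
  rw [h1] at h3
  rw [← LinearMap.range_self_comp_adjoint, ← h3]
  congr 1
  ext1 x
  exact (mulV_mul _ _ x).symm.trans (by rw [h2]; rfl)

theorem mulV_add {d : ℕ} (A : Mat d) (x y : Vec d) : mulV A (x + y) = mulV A x + mulV A y :=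
  map_add (Matrix.toEuclideanLin A) x y

theorem mulV_sub {d : ℕ} (A : Mat d) (x y : Vec d) : mulV A (x - y) = mulV A x - mulV A y :=
  map_sub (Matrix.toEuclideanLin A) x y

theorem sub_mulV {d : ℕ} (A B : Mat d) (x : Vec d) : mulV (A - B) x = mulV A x - mulV B x := by
  simp [mulV]

theorem mulV_nonsing_inv {d : ℕ} {A : Mat d} (hA : A.PosDef) (x : Vec d) :
    mulV A (mulV A⁻¹ x) = x := by
  rw [← mulV_mul, Matrix.mul_nonsing_inv _ (hA.isUnit.map Matrix.detMonoidHom)]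
  simp [mulV]

theorem nonsing_inv_mulV {d : ℕ} {A : Mat d} (hA : A.PosDef) (x : Vec d) :
    mulV A⁻¹ (mulV A x) = x := by
  rw [← mulV_mul, Matrix.nonsing_inv_mul _ (hA.isUnit.map Matrix.detMonoidHom)]
  simp [mulV]

namespace Procedure

variable {d : ℕ} (K : Procedure d)

theorem D_posDef {S : Mat d} (hS : S.PosDef) : (K.D S).PosDef := by
  simpa [D] using Matrix.PosDef.posSemidef_add (K.dominates S hS) hS

/-- The noise-to-statistics map `(b₀, w) ↦ S⁻¹ b₀ - Δ(S)⁻¹ (b₀ + w)` takes its values in `xiSpace S`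
if the noise `w` lies in the range of `Δ(S) - S`. -/
theorem xi_mem_xiSpace {S : Mat d} (hS : S.PosDef) (x w : Vec d)
    (hw : w ∈ LinearMap.range (Matrix.toEuclideanLin (K.D S - S))) :
    K.xi x S w ∈ K.xiSpace S := by
  obtain ⟨u, rfl⟩ := hw
  refine ⟨x - mulV S u, ?_⟩
  change mulV _ _ = K.xi x S (mulV _ u)
  simp only [xi, whitened, mulV_sub, mulV_add, sub_mulV, nonsing_inv_mulV hS,
    nonsing_inv_mulV (K.D_posDef hS)]
  abel

/-- Every point of `xiSpace S × ℝ^d` is a value of the pair `(ξ, b + w)`. -/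
theorem exists_xi_eq {S : Mat d} (hS : S.PosDef) (v y : Vec d) (hv : v ∈ K.xiSpace S) :
    ∃ x w, w ∈ LinearMap.range (Matrix.toEuclideanLin (K.D S - S)) ∧ K.xi x S w = v ∧
      whitened x w = y := by
  obtain ⟨u, rfl⟩ := hv
  have hD := K.D_posDef hS
  change ∃ x w, _ ∧ _ = mulV _ u ∧ _
  refine ⟨mulV S (mulV (S⁻¹ - (K.D S)⁻¹) u) + mulV S (mulV (K.D S)⁻¹ y),
    mulV (K.D S - S) (mulV (K.D S)⁻¹ y - mulV (K.D S)⁻¹ u), ⟨_, rfl⟩, ?_, ?_⟩ <;>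
  · simp only [xi, whitened, mulV_sub, mulV_add, sub_mulV, nonsing_inv_mulV hS,
      mulV_nonsing_inv hS, mulV_nonsing_inv hD]
    abel

/-- The law of `(ξ, b + ω)` under exact Gaussian sampling is absolutely continuous with respect to
Lebesgue measure on `xiSpace S × ℝ^d`. -/
theorem map_xi_whitened_absolutelyContinuous {S : Mat d} (hS : S.PosDef) (β : Vec d) :
    ((stdGaussian (Vec d)).prod (stdGaussian (Vec d))).map
      (fun z => (K.xi (β + mulV (psdSqrt S) z.1) S (mulV (K.M S) z.2),
        whitened (β + mulV (psdSqrt S) z.1) (mulV (K.M S) z.2)))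
      ≪ (subspaceVolume (K.xiSpace S)).prod volume := by
  have hM : ∀ z : Vec d,
      mulV (K.M S) z ∈ LinearMap.range (Matrix.toEuclideanLin (K.D S - S)) := fun z => by
    rw [← range_psdSqrt (A := K.D S - S) (K.dominates S hS)]
    exact ⟨z, rfl⟩
  let A := Matrix.toEuclideanLin (psdSqrt S)
  let B := Matrix.toEuclideanLin (K.M S)
  let g : Vec d × Vec d →ₗ[ℝ] Vec d :=
    A ∘ₗ LinearMap.fst ℝ (Vec d) (Vec d) + B ∘ₗ LinearMap.snd ℝ (Vec d) (Vec d)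
  let f : Vec d × Vec d →ₗ[ℝ] Vec d :=
    Matrix.toEuclideanLin S⁻¹ ∘ₗ A ∘ₗ LinearMap.fst ℝ (Vec d) (Vec d)
      - Matrix.toEuclideanLin (K.D S)⁻¹ ∘ₗ g
  have hf : ∀ z, f z = K.xi (mulV (psdSqrt S) z.1) S (mulV (K.M S) z.2) := fun z => rfl
  have hg : ∀ z, g z = whitened (mulV (psdSqrt S) z.1) (mulV (K.M S) z.2) := fun z => rfl
  have hfV : ∀ z, f z ∈ K.xiSpace S := fun z => by
    rw [hf]
    exact K.xi_mem_xiSpace hS _ _ (hM _)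
  let L : Vec d × Vec d →ₗ[ℝ] K.xiSpace S × Vec d := (f.codRestrict _ hfV).prod g
  have hL : Function.Surjective L := by
    rintro ⟨⟨v, hv⟩, y⟩
    obtain ⟨x, w, hw, hx, hy⟩ := K.exists_xi_eq hS v y hv
    rw [← range_psdSqrt (A := K.D S - S) (K.dominates S hS)] at hw
    obtain ⟨z₂, rfl⟩ := hw
    have hx' : x ∈ LinearMap.range (Matrix.toEuclideanLin (psdSqrt S)) := by
      rw [range_psdSqrt hS.posSemidef]
      exact ⟨mulV S⁻¹ x, mulV_nonsing_inv hS x⟩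
    obtain ⟨z₁, rfl⟩ := hx'
    exact ⟨(z₁, z₂), Prod.ext (Subtype.ext hx) hy⟩
  let c : K.xiSpace S × Vec d := (⟨mulV (S⁻¹ - (K.D S)⁻¹) β, β, rfl⟩, β)
  have hι : Measurable (Prod.map (Subtype.val : K.xiSpace S → Vec d) (id : Vec d → Vec d)) := by
    fun_prop
  have hcL : Measurable fun z => c + L z :=
    (measurable_const_add c).comp L.continuous_of_finiteDimensional.measurable
  have hmap : (fun z : Vec d × Vec d => (K.xi (β + mulV (psdSqrt S) z.1) S (mulV (K.M S) z.2),
      whitened (β + mulV (psdSqrt S) z.1) (mulV (K.M S) z.2)))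
      = Prod.map (Subtype.val : K.xiSpace S → Vec d) id ∘ fun z => c + L z := by
    funext z
    refine Prod.ext ?_ ?_
    · change _ = mulV (S⁻¹ - (K.D S)⁻¹) β + f z
      rw [hf]
      simp only [xi, whitened, mulV_add, sub_mulV]
      abel
    · change _ = β + g z
      rw [hg]
      simp only [whitened]
      abel
  have hvol : (subspaceVolume (K.xiSpace S)).prod (volume : Measure (Vec d))
      = ((stdOrthonormalBasis ℝ (K.xiSpace S)).toBasis.addHaar.prod volume).map
        (Prod.map Subtype.val id) := by
    rw [← Measure.map_prod_map _ _ measurable_subtype_coe measurable_id, Measure.map_id]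
    rfl
  rw [hmap, ← Measure.map_map hι hcL, hvol]
  refine Measure.AbsolutelyContinuous.map ?_ hι
  exact ((stdGaussian_absolutelyContinuous.prod stdGaussian_absolutelyContinuous).map hcL).trans
    (map_absolutelyContinuous_of_surjective L hL c)

end Procedure

end Knockoff

namespace Knockoff

/-! ### Regularity of the rejection set as a function of the data -/

/-- The symmetric part of an array. -/
noncomputable def symPart {d : ℕ} (A : Fin d → Fin d → ℝ) : Mat d :=
  Matrix.of fun i j => (A i j + A j i) / 2

theorem symPart_eq {d : ℕ} {A : Mat d} (hA : A.IsSymm) : symPart (fun i j => A i j) = A := by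
  ext i j
  simp only [symPart, Matrix.of_apply, hA.apply i j]
  ring

theorem isSymm_symPart {d : ℕ} (A : Fin d → Fin d → ℝ) : (symPart A).IsSymm := by
  ext i j
  simp only [symPart, Matrix.transpose_apply, Matrix.of_apply, add_comm]

theorem continuous_symPart {d : ℕ} : Continuous (symPart (d := d)) := by
  unfold symPart
  refine continuous_pi fun i => continuous_pi fun j => ?_
  change Continuous fun A : Fin d → Fin d → ℝ => (A i j + A j i) / 2
  fun_prop

theorem isOpen_posDef_symPart {d : ℕ} :
    IsOpen {A : Fin d → Fin d → ℝ | (symPart A).PosDef} := by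
  have key : ∀ A : Fin d → Fin d → ℝ, (symPart A).PosDef ↔
      ∀ x ∈ Metric.sphere (0 : Fin d → ℝ) 1, 0 < x ⬝ᵥ (symPart A).mulVec x := by
    intro A
    rw [Matrix.posDef_iff_dotProduct_mulVec]
    constructor
    · rintro ⟨-, h⟩ x hx
      have hx0 : x ≠ 0 := by
        rintro rfl
        simp at hx
      simpa using h hx0
    · refine fun h => ⟨(Matrix.conjTranspose_eq_transpose_of_trivial _).trans (isSymm_symPart A), fun x hx => ?_⟩
      have hn : 0 < ‖x‖ := norm_pos_iff.2 hx
      have := h (‖x‖⁻¹ • x) (by simp [norm_smul, hn.ne'])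
      rw [Matrix.mulVec_smul, dotProduct_smul, smul_dotProduct, smul_smul, smul_eq_mul] at this
      simpa using pos_of_mul_pos_right this (by positivity)
  simp only [key]
  rw [isOpen_iff_eventually]
  intro A hA
  have hc : Continuous fun p : (Fin d → Fin d → ℝ) × (Fin d → ℝ) =>
      p.2 ⬝ᵥ (symPart p.1).mulVec p.2 :=
    continuous_snd.dotProduct ((continuous_symPart.comp continuous_fst).matrix_mulVec
      continuous_snd)
  refine (isCompact_sphere _ _).eventually_forall_of_forall_eventually fun x hx => ?_
  exact (isOpen_lt continuous_const hc).mem_nhds (hA x hx)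

theorem continuousAt_inv {d : ℕ} {A : Mat d} (hA : A.PosDef) :
    ContinuousAt (fun B : Mat d => B⁻¹) A := by
  have : (fun B : Mat d => B⁻¹) = fun B : Mat d => (B.det)⁻¹ • B.adjugate := by
    funext B
    rw [Matrix.inv_def, Ring.inverse_eq_inv']
  rw [this]
  exact (continuous_id.matrix_det.continuousAt.inv₀ hA.det_pos.ne').smul
    continuous_id.matrix_adjugate.continuousAt

theorem continuous_mulV {d : ℕ} : Continuous fun p : Mat d × Vec d => mulV p.1 p.2 := by
  have : (fun p : Mat d × Vec d => mulV p.1 p.2)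
      = fun p : Mat d × Vec d => WithLp.toLp 2 (p.1.mulVec p.2.ofLp) := by
    funext p
    simp [mulV, Matrix.toLpLin_apply]
  rw [this]
  refine (PiLp.continuous_toLp 2 _).comp (continuous_fst.matrix_mulVec ?_)
  exact (PiLp.continuous_ofLp 2 _).comp continuous_snd

theorem _root_.ContinuousAt.mulV {d : ℕ} {X : Type*} [TopologicalSpace X] {A : X → Mat d}
    {x : X → Vec d} {a : X} (hA : ContinuousAt A a) (hx : ContinuousAt x a) :
    ContinuousAt (fun y => Knockoff.mulV (A y) (x y)) a :=
  ContinuousAt.comp (f := fun y => (A y, x y)) continuous_mulV.continuousAt (hA.prodMk hx)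

theorem continuous_flip {d : ℕ} (j : Fin d) : Continuous (flip (d := d) j) := by
  unfold flip
  refine (PiLp.continuous_toLp 2 _).comp ?_
  exact (PiLp.continuous_ofLp 2 _).update j (by fun_prop)

open scoped MatrixOrder Matrix.Norms.L2Operator in
theorem continuousOn_psdSqrt {d : ℕ} : ContinuousOn (psdSqrt (d := d)) {S | S.PosSemidef} := by
  simpa [Matrix.nonneg_iff_posSemidef] using! CFC.continuousOn_sqrt (A := Mat d)

namespace Procedure

variable {d : ℕ} (K : Procedure d)

theorem continuousOn_D (hK : K.IsContinuous) : ContinuousOn K.D {S | S.PosDef} :=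
  (continuous_id.matrix_diagonal (n := Fin d) (R := ℝ)).comp_continuousOn hK.1

theorem continuousOn_M (hK : K.IsContinuous) : ContinuousOn K.M {S | S.PosDef} :=
  continuousOn_psdSqrt.comp ((K.continuousOn_D hK).sub continuousOn_id) K.dominates

/-- The space of an estimate, an array from which the covariance matrix is read off, and standard
normal noise. -/
abbrev Data (d : ℕ) := (Vec d × (Fin d → Fin d → ℝ)) × Vec d

/-- The whitening noise. -/
noncomputable def noiseOf (q : Data d) : Vec d := mulV (K.M (symPart q.1.2)) q.2

/-- The pair `(ξ, b + ω)`. -/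
noncomputable def statsOf (q : Data d) : Vec d × Vec d :=
  (K.xi q.1.1 (symPart q.1.2) (K.noiseOf q), whitened q.1.1 (K.noiseOf q))

/-- The pair `(W⁺, W⁻)`. -/
noncomputable def pairOf (p : Vec d × Vec d) : (Fin d → ℝ) × (Fin d → ℝ) :=
  (K.Wplus p.1 p.2, K.Wminus p.1 p.2)

/-- The rejection set as a function of the data. -/
noncomputable def rejectionOf (α : ℝ) (q : Data d) : Finset (Fin d) :=
  K.rejectionSet α q.1.1 (symPart q.1.2) (K.noiseOf q)

theorem isOpen_posDef_data : IsOpen {q : Data d | (symPart q.1.2).PosDef} :=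
  isOpen_posDef_symPart.preimage (by fun_prop)

theorem continuousAt_comp_symPart {Y : Type*} [TopologicalSpace Y] {f : Mat d → Y}
    (hf : ContinuousOn f {S | S.PosDef}) {q : Data d} (hq : (symPart q.1.2).PosDef) :
    ContinuousAt (fun q : Data d => f (symPart q.1.2)) q := by
  have h : ContinuousOn (fun q : Data d => f (symPart q.1.2))
      {q : Data d | (symPart q.1.2).PosDef} :=
    hf.comp (continuous_symPart.comp (by fun_prop)).continuousOn fun q hq => hq
  exact h.continuousAt (isOpen_posDef_data.mem_nhds hq)

theorem continuousAt_statsOf (hK : K.IsContinuous) {q : Data d} (hq : (symPart q.1.2).PosDef) :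
    ContinuousAt K.statsOf q := by
  have hb : ContinuousAt (fun q : Data d => q.1.1) q := by fun_prop
  have hz : ContinuousAt (fun q : Data d => q.2) q := by fun_prop
  have hM : ContinuousAt (fun q : Data d => K.M (symPart q.1.2)) q :=
    continuousAt_comp_symPart (K.continuousOn_M hK) hq
  have hS : ContinuousAt (fun q : Data d => (symPart q.1.2)⁻¹) q :=
    continuousAt_comp_symPart (f := fun A : Mat d => A⁻¹)
      (fun A hA => (continuousAt_inv hA).continuousWithinAt) hq
  have hD : ContinuousAt (fun q : Data d => (K.D (symPart q.1.2))⁻¹) q :=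
    continuousAt_comp_symPart (f := fun A : Mat d => (K.D A)⁻¹)
      (fun A hA => (continuousAt_inv (K.D_posDef hA)).comp_continuousWithinAt
        (K.continuousOn_D hK A hA)) hq
  have hn : ContinuousAt K.noiseOf q := hM.mulV hz
  have hw : ContinuousAt (fun q : Data d => whitened q.1.1 (K.noiseOf q)) q := hb.add hn
  have hx : ContinuousAt (fun q : Data d => K.xi q.1.1 (symPart q.1.2) (K.noiseOf q)) q :=
    (hS.mulV hb).sub (hD.mulV hw)
  exact hx.prodMk hw

theorem continuous_pairOf (hK : K.IsContinuous) : Continuous K.pairOf := by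
  refine hK.2.prodMk (continuous_pi fun j => ?_)
  exact (continuous_apply j).comp (hK.2.comp (continuous_fst.prodMk
    ((continuous_flip j).comp continuous_snd)))

theorem rejectionOf_of_posDef (α : ℝ) {q : Data d} (hq : (symPart q.1.2).PosDef) :
    K.rejectionOf α q = seqStepPair α (K.pairOf (K.statsOf q)) := if_pos hq

theorem measurable_rejectionOf (hK : K.IsContinuous) (α : ℝ) :
    Measurable (K.rejectionOf α) := by
  refine measurable_of_restrict_of_restrict_compl isOpen_posDef_data.measurableSet ?_ ?_
  · have h : ContinuousOn (fun q => K.pairOf (K.statsOf q))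
        {q : Data d | (symPart q.1.2).PosDef} := fun q hq =>
      ((K.continuous_pairOf hK).continuousAt.comp
        (K.continuousAt_statsOf hK hq)).continuousWithinAt
    have h' := (measurable_seqStepPair α).comp h.domRestrict.measurable
    convert h' using 1
    funext q
    exact K.rejectionOf_of_posDef α q.2
  · convert measurable_const (a := (∅ : Finset (Fin d))) using 1
    funext q
    exact if_neg q.2

theorem continuousAt_rejectionOf (hK : K.IsContinuous) (α : ℝ) {q : Data d}
    (hq : (symPart q.1.2).PosDef) (hg : K.statsOf q ∈ K.goodSet) :
    ContinuousAt (K.rejectionOf α) q := by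
  have h : ContinuousAt (fun q => K.pairOf (K.statsOf q)) q :=
    (K.continuous_pairOf hK).continuousAt.comp (K.continuousAt_statsOf hK hq)
  refine tendsto_nhds_of_eventually_eq ?_
  filter_upwards [isOpen_posDef_data.mem_nhds hq,
    h.eventually (eventually_seqStepPair_eq α (K.pairOf (K.statsOf q)) hg.1 hg.2.2)]
    with q' h1 h2
  rw [K.rejectionOf_of_posDef α h1, K.rejectionOf_of_posDef α hq, h2]

end Procedure
end Knockoff

namespace Knockoff

/-! ### Convergence in distribution -/

section Convergence

variable {E : Type*} [TopologicalSpace E] [MeasurableSpace E] [OpensMeasurableSpace E]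
  {Ω₁ Ω₂ : ℕ → Type*} [∀ n, MeasurableSpace (Ω₁ n)] [∀ n, MeasurableSpace (Ω₂ n)]
  {P₁ : ∀ n, Measure (Ω₁ n)} {P₂ : ∀ n, Measure (Ω₂ n)} [∀ n, IsProbabilityMeasure (P₁ n)]
  [∀ n, IsProbabilityMeasure (P₂ n)]
  {Ω' Ω'' : Type*} [MeasurableSpace Ω'] [MeasurableSpace Ω''] {P' : Measure Ω'} {P'' : Measure Ω''}
  [IsProbabilityMeasure P'] [IsProbabilityMeasure P'']

/-- Convergence in distribution depends only on the laws. -/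
theorem tendstoInDistribution_of_map_eq {X₁ : ∀ n, Ω₁ n → E} {X₂ : ∀ n, Ω₂ n → E} {Z : Ω' → E}
    {Z' : Ω'' → E} (h : TendstoInDistribution X₁ atTop Z P₁ P')
    (hX : ∀ n, AEMeasurable (X₂ n) (P₂ n)) (hZ : AEMeasurable Z' P'')
    (hXeq : ∀ n, (P₂ n).map (X₂ n) = (P₁ n).map (X₁ n)) (hZeq : P''.map Z' = P'.map Z) :
    TendstoInDistribution X₂ atTop Z' P₂ P'' := by
  refine ⟨hX, hZ, ?_⟩
  have e : (⟨P''.map Z', Measure.isProbabilityMeasure_map hZ⟩ : ProbabilityMeasure E)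
      = ⟨P'.map Z, Measure.isProbabilityMeasure_map h.aemeasurable_limit⟩ := Subtype.ext hZeq
  rw [e]
  exact (tendsto_congr fun n => Subtype.ext (hXeq n)).2 h.tendsto

/-- **Mapping theorem**: convergence in distribution is preserved by maps that are almost surely
continuous at the limit. -/
theorem tendstoInDistribution_comp_of_ae_continuousAt [HasOuterApproxClosed E] {F : Type*}
    [TopologicalSpace F] [MeasurableSpace F] [BorelSpace F] {X : ∀ n, Ω₁ n → E} {Z : Ω' → E}
    {g : E → F} (h : TendstoInDistribution X atTop Z P₁ P') (hg : Measurable g)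
    (hc : ∀ᵐ o ∂P', ContinuousAt g (Z o)) :
    TendstoInDistribution (fun n o => g (X n o)) atTop (fun o => g (Z o)) P₁ P' where
  forall_aemeasurable n := hg.comp_aemeasurable (h.forall_aemeasurable n)
  aemeasurable_limit := hg.comp_aemeasurable h.aemeasurable_limit
  tendsto := by
    refine tendsto_of_forall_isOpen_le_liminf' fun G hG => ?_
    have key := ProbabilityMeasure.le_liminf_measure_open_of_tendsto h.tendsto
      (isOpen_interior (s := g ⁻¹' G))
    simp only [ProbabilityMeasure.coe_mk] at key ⊢
    have e1 : P'.map (fun o => g (Z o)) G ≤ P'.map Z (interior (g ⁻¹' G)) := by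
      rw [Measure.map_apply_of_aemeasurable (f := fun o => g (Z o))
        (hg.comp_aemeasurable h.aemeasurable_limit) hG.measurableSet,
        Measure.map_apply_of_aemeasurable h.aemeasurable_limit
        isOpen_interior.measurableSet]
      refine measure_mono_ae ?_
      filter_upwards [hc] with o ho hoG
      exact mem_interior_iff_mem_nhds.2 (ho (hG.mem_nhds hoG))
    refine e1.trans (key.trans (liminf_le_liminf (.of_forall fun n => ?_)))
    rw [Measure.map_apply_of_aemeasurable (h.forall_aemeasurable n) isOpen_interior.measurableSet,
      Measure.map_apply_of_aemeasurable (f := fun o => g (X n o))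
        (hg.comp_aemeasurable (h.forall_aemeasurable n))
        hG.measurableSet]
    exact measure_mono fun o ho => interior_subset (s := g ⁻¹' G) ho

/-- Expectations of bounded continuous functions converge. -/
theorem tendsto_integral_of_tendstoInDistribution {X : ∀ n, Ω₁ n → E} {Z : Ω' → E}
    (h : TendstoInDistribution X atTop Z P₁ P') (f : BoundedContinuousFunction E ℝ) :
    Tendsto (fun n => ∫ o, f (X n o) ∂(P₁ n)) atTop (𝓝 (∫ o, f (Z o) ∂P')) := by
  have := ProbabilityMeasure.tendsto_iff_forall_integral_tendsto.1 h.tendsto f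
  have hf : ∀ μ : Measure E, AEStronglyMeasurable f μ := fun μ =>
    f.continuous.measurable.aestronglyMeasurable
  simp only [ProbabilityMeasure.coe_mk] at this
  rw [integral_map h.aemeasurable_limit (hf _)] at this
  refine this.congr fun n => ?_
  rw [integral_map (h.forall_aemeasurable n) (hf _)]

theorem map_comp_eval_infinitePi {H : Type*} [MeasurableSpace H] (n : ℕ) {f : Ω₁ n → H}
    (hf : AEMeasurable f (P₁ n)) :
    AEMeasurable (fun o : ∀ n, Ω₁ n => f (o n)) (Measure.infinitePi P₁) ∧
      (Measure.infinitePi P₁).map (fun o => f (o n)) = (P₁ n).map f := by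
  have mp := measurePreserving_eval_infinitePi P₁ n
  have hf' : AEMeasurable f ((Measure.infinitePi P₁).map (Function.eval n)) := by
    rwa [mp.map_eq]
  refine ⟨hf'.comp_measurable mp.measurable, ?_⟩
  conv_rhs => rw [← mp.map_eq,
    AEMeasurable.map_map_of_aemeasurable hf' mp.measurable.aemeasurable]
  rfl

/-- **Slutsky's theorem** with a probability space that depends on `n`. -/
theorem tendstoInDistribution_prodMk_const {G G' : Type*} [SeminormedAddCommGroup G]
    [SecondCountableTopology G] [MeasurableSpace G] [BorelSpace G] [SeminormedAddCommGroup G']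
    [SecondCountableTopology G'] [MeasurableSpace G'] [BorelSpace G']
    {X : ∀ n, Ω₁ n → G} {Z : Ω' → G} (h : TendstoInDistribution X atTop Z P₁ P')
    {Y : ∀ n, Ω₁ n → G'} {c : G'} (hYm : ∀ n, AEMeasurable (Y n) (P₁ n))
    (hY : ∀ ε : ℝ, 0 < ε → Tendsto (fun n => P₁ n {o | ε ≤ ‖Y n o - c‖}) atTop (𝓝 0)) :
    TendstoInDistribution (fun n o => (X n o, Y n o)) atTop (fun o => (Z o, c)) P₁ P' := by
  have mp : ∀ n, MeasurePreserving (Function.eval n) (Measure.infinitePi P₁) (P₁ n) :=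
    measurePreserving_eval_infinitePi P₁
  have h1 : TendstoInDistribution (fun n (o : ∀ n, Ω₁ n) => X n (o n)) atTop Z
      (fun _ => Measure.infinitePi P₁) P' :=
    tendstoInDistribution_of_map_eq h (fun n => (map_comp_eval_infinitePi n (h.forall_aemeasurable n)).1)
      h.aemeasurable_limit (fun n => (map_comp_eval_infinitePi n (h.forall_aemeasurable n)).2) rfl
  have h2 : TendstoInMeasure (Measure.infinitePi P₁) (fun n (o : ∀ n, Ω₁ n) => Y n (o n)) atTop
      (fun _ => c) := by
    rw [tendstoInMeasure_iff_norm]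
    intro ε hε
    refine (hY ε hε).congr fun n => ?_
    have : NullMeasurableSet {o | ε ≤ ‖Y n o - c‖} (P₁ n) :=
      nullMeasurableSet_le aemeasurable_const
        ((continuous_norm.comp (continuous_id.sub continuous_const)).measurable.comp_aemeasurable
          (hYm n))
    exact ((mp n).measure_preimage this).symm
  have h3 := h1.prodMk_of_tendstoInMeasure_const _ _ Z h2 (fun n => (map_comp_eval_infinitePi n (hYm n)).1)
  have hpair : ∀ n, AEMeasurable (fun o => (X n o, Y n o)) (P₁ n) := fun n =>
    (h.forall_aemeasurable n).prodMk (hYm n)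
  exact tendstoInDistribution_of_map_eq h3 hpair (h.aemeasurable_limit.prodMk aemeasurable_const)
    (fun n => ((map_comp_eval_infinitePi n (hpair n)).2).symm) rfl

theorem map_prodMk_prod {G G' H : Type*} [MeasurableSpace G] [MeasurableSpace G']
    [MeasurableSpace H] {γ : Measure H} [IsProbabilityMeasure γ] {Z : Ω' → G} {Y : H → G'}
    (hZ : AEMeasurable Z P') (hY : AEMeasurable Y γ) :
    (P'.prod γ).map (fun q => (Z q.1, Y q.2)) = (P'.map Z).prod (γ.map Y) := by
  have h1 : HasLaw (fun q : Ω' × H => Z q.1) (P'.map Z) (P'.prod γ) :=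
    HasLaw.comp (X := Prod.fst) ⟨hZ, rfl⟩ measurePreserving_fst.hasLaw
  have h2 : HasLaw (fun q : Ω' × H => Y q.2) (γ.map Y) (P'.prod γ) :=
    HasLaw.comp (X := Prod.snd) ⟨hY, rfl⟩ measurePreserving_snd.hasLaw
  rw [(indepFun_iff_map_prod_eq_prod_map_map h1.aemeasurable h2.aemeasurable).1
    (indepFun_prod₀ hZ hY), h1.map_eq, h2.map_eq]

/-- Convergence in distribution is preserved if independent noise with a fixed law is adjoined. -/
theorem tendstoInDistribution_prodMk_indep {G G' : Type*}
    [TopologicalSpace G] [SecondCountableTopology G] [TopologicalSpace.PseudoMetrizableSpace G]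
    [MeasurableSpace G] [BorelSpace G]
    [TopologicalSpace G'] [SecondCountableTopology G'] [TopologicalSpace.PseudoMetrizableSpace G']
    [MeasurableSpace G'] [BorelSpace G']
    {X : ∀ n, Ω₁ n → G} {Z : Ω' → G} (h : TendstoInDistribution X atTop Z P₁ P')
    {Y : ∀ n, Ω₁ n → G'} {γ : Measure G'} [IsProbabilityMeasure γ]
    (hY : ∀ n, HasLaw (Y n) γ (P₁ n)) (hXY : ∀ n, IndepFun (X n) (Y n) (P₁ n)) :
    TendstoInDistribution (fun n o => (X n o, Y n o)) atTop
      (fun q : Ω' × G' => (Z q.1, q.2)) P₁ (P'.prod γ) := by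
  have hZ : AEMeasurable (fun q : Ω' × G' => (Z q.1, q.2)) (P'.prod γ) :=
    h.aemeasurable_limit.comp_fst.prodMk measurable_snd.aemeasurable
  refine ⟨fun n => (h.forall_aemeasurable n).prodMk (hY n).aemeasurable, hZ, ?_⟩
  have hlim : (P'.prod γ).map (fun q : Ω' × G' => (Z q.1, q.2)) = (P'.map Z).prod γ := by
    simpa using map_prodMk_prod h.aemeasurable_limit (aemeasurable_id (μ := γ))
  let γ' : ProbabilityMeasure G' := ⟨γ, inferInstance⟩
  let μ (n : ℕ) : ProbabilityMeasure G :=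
    ⟨(P₁ n).map (X n), Measure.isProbabilityMeasure_map (h.forall_aemeasurable n)⟩
  let μ' : ProbabilityMeasure G :=
    ⟨P'.map Z, Measure.isProbabilityMeasure_map h.aemeasurable_limit⟩
  have ht : Tendsto μ atTop (𝓝 μ') := h.tendsto
  have key : Tendsto (fun n => (μ n).prod γ') atTop (𝓝 (μ'.prod γ')) :=
    (ProbabilityMeasure.continuous_prod (α := G) (β := G')).continuousAt.tendsto.comp
      (ht.prodMk_nhds (tendsto_const_nhds (x := γ')))
  have e : (⟨(P'.prod γ).map (fun q : Ω' × G' => (Z q.1, q.2)),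
      Measure.isProbabilityMeasure_map hZ⟩ : ProbabilityMeasure (G × G'))
      = ⟨(P'.map Z).prod γ, hlim ▸ Measure.isProbabilityMeasure_map hZ⟩ := Subtype.ext hlim
  rw [e]
  refine (tendsto_congr fun n => Subtype.ext ?_).2 key
  change (P₁ n).map _ = ((P₁ n).map _).prod γ
  rw [(indepFun_iff_map_prod_eq_prod_map_map (h.forall_aemeasurable n)
    (hY n).aemeasurable).1 (hXY n), (hY n).map_eq]

end Convergence
end Knockoff

namespace Knockoff

/-! ### Asymptotics of the knockoff procedure -/

theorem measurable_mulV {d : ℕ} (A : Mat d) : Measurable (mulV A) :=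
  (Matrix.toEuclideanLin A).continuous_of_finiteDimensional.measurable

theorem multivariateGaussian_eq_map {d : ℕ} (μ : Vec d) (S : Mat d) :
    multivariateGaussian μ S
      = (stdGaussian (Vec d)).map (fun z => μ + mulV (psdSqrt S) z) := rfl

/-- Convergence in probability of the entries implies convergence in probability in norm. -/
theorem TendstoInProbability.tendsto_norm {d : ℕ} {Ω : ℕ → Type*} [∀ n, MeasurableSpace (Ω n)]
    {P : ∀ n, Measure (Ω n)} {X : ∀ n, Ω n → Mat d} {S : Mat d}
    (h : TendstoInProbability P X S) (ε : ℝ) (hε : 0 < ε) :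
    Tendsto (fun n => P n {o | ε ≤ ‖(fun i j => X n o i j) - fun i j => S i j‖}) atTop (𝓝 0) := by
  have h0 : Tendsto (fun n => ∑ i, ∑ j, P n {o | ε ≤ |X n o i j - S i j|}) atTop (𝓝 0) := by
    simpa using tendsto_finsetSum (Finset.univ : Finset (Fin d)) fun i _ =>
      tendsto_finsetSum (Finset.univ : Finset (Fin d)) fun j _ => h i j ε hε
  refine tendsto_of_tendsto_of_tendsto_of_le_of_le tendsto_const_nhds h0 (fun _ => zero_le)
    fun n => ?_
  have hsub : {o | ε ≤ ‖(fun i j => X n o i j) - fun i j => S i j‖}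
      ⊆ ⋃ i, ⋃ j, {o | ε ≤ |X n o i j - S i j|} := by
    intro o ho
    by_contra hcon
    simp only [Set.mem_iUnion, Set.mem_ofPred_eq, not_exists, not_le] at hcon
    refine not_le.2 ?_ (Set.mem_ofPred_eq.mp ho)
    exact (pi_norm_lt_iff hε).2 fun i => (pi_norm_lt_iff hε).2 fun j => hcon i j
  calc _ ≤ P n (⋃ i, ⋃ j, {o | ε ≤ |X n o i j - S i j|}) := measure_mono hsub
    _ ≤ ∑ i, P n (⋃ j, {o | ε ≤ |X n o i j - S i j|}) := measure_iUnion_fintype_le _ _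
    _ ≤ _ := Finset.sum_le_sum fun i _ => measure_iUnion_fintype_le _ _

namespace Procedure

variable {d : ℕ} (K : Procedure d)

theorem measurable_rejectionSet (hK : K.IsContinuous) (α : ℝ) {S : Mat d} (hS : S.PosDef) :
    Measurable fun p : Vec d × Vec d => K.rejectionSet α p.1 S p.2 := by
  have hw : Measurable fun p : Vec d × Vec d => whitened p.1 p.2 := measurable_fst.add measurable_snd
  have hx : Measurable fun p : Vec d × Vec d => K.xi p.1 S p.2 :=
    ((measurable_mulV _).comp measurable_fst).sub ((measurable_mulV _).comp hw)
  have h := (measurable_seqStepPair α).comp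
    ((K.continuous_pairOf hK).measurable.comp (hx.prodMk hw))
  convert h using 1
  funext p
  exact if_pos hS

/-- Under exact Gaussian sampling the rejection set is almost surely computed at a point of the
good set. -/
theorem ae_mem_goodSet {Ω' : Type*} [MeasurableSpace Ω'] {P' : Measure Ω'} [IsProbabilityMeasure P']
    {β : Vec d} {S : Mat d} (hS : S.PosDef) {b : Ω' → Vec d}
    (hb : HasLaw b (multivariateGaussian β S) P')
    (hE : ((subspaceVolume (K.xiSpace S)).prod volume) (K.goodSetᶜ) = 0) :
    ∀ᵐ q ∂(P'.prod (stdGaussian (Vec d))),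
      (K.xi (b q.1) S (mulV (K.M S) q.2), whitened (b q.1) (mulV (K.M S) q.2)) ∈ K.goodSet := by
  let Φ : Vec d × Vec d → Vec d × Vec d := fun p =>
    (K.xi p.1 S (mulV (K.M S) p.2), whitened p.1 (mulV (K.M S) p.2))
  have hw : Measurable fun p : Vec d × Vec d => whitened p.1 (mulV (K.M S) p.2) :=
    measurable_fst.add ((measurable_mulV _).comp measurable_snd)
  have hΦ : Measurable Φ :=
    (((measurable_mulV _).comp measurable_fst).sub ((measurable_mulV _).comp hw)).prodMk hw
  have hA : Measurable fun z : Vec d => β + mulV (psdSqrt S) z :=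
    measurable_const.add (measurable_mulV _)
  have hq : AEMeasurable (fun q : Ω' × Vec d => (b q.1, q.2)) (P'.prod (stdGaussian (Vec d))) :=
    hb.aemeasurable.comp_fst.prodMk measurable_snd.aemeasurable
  have hz : Measurable fun z : Vec d × Vec d => (β + mulV (psdSqrt S) z.1, z.2) :=
    (hA.comp measurable_fst).prodMk measurable_snd
  have e1 : (P'.prod (stdGaussian (Vec d))).map (fun q => (b q.1, q.2))
      = ((stdGaussian (Vec d)).prod (stdGaussian (Vec d))).map
        (fun z => (β + mulV (psdSqrt S) z.1, z.2)) := by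
    have l := map_prodMk_prod hb.aemeasurable (aemeasurable_id (μ := stdGaussian (Vec d)))
    have r := map_prodMk_prod (P' := stdGaussian (Vec d)) hA.aemeasurable
      (aemeasurable_id (μ := stdGaussian (Vec d)))
    rw [hb.map_eq, multivariateGaussian_eq_map] at l
    exact l.trans r.symm
  have hac := K.map_xi_whitened_absolutelyContinuous hS β
  have e2 : (P'.prod (stdGaussian (Vec d))).map (fun q => Φ (b q.1, q.2))
      = ((stdGaussian (Vec d)).prod (stdGaussian (Vec d))).map
        (fun z => Φ (β + mulV (psdSqrt S) z.1, z.2)) := by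
    have l := AEMeasurable.map_map_of_aemeasurable hΦ.aemeasurable hq
    rw [e1, Measure.map_map hΦ hz] at l
    exact l.symm
  exact ae_of_ae_map (hΦ.comp_aemeasurable hq)
    (e2 ▸ hac.ae_le (show ∀ᵐ p ∂(subspaceVolume (K.xiSpace S)).prod volume, p ∈ K.goodSet from hE))

/-- The law of the rejection set may be computed from standard normal noise. -/
theorem map_rejectionSet_eq (hK : K.IsContinuous) (α : ℝ) {Ω' : Type*} [MeasurableSpace Ω']
    {P' : Measure Ω'} [IsProbabilityMeasure P'] {S : Mat d} (hS : S.PosDef) {b ω : Ω' → Vec d}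
    (hb : AEMeasurable b P') (hω : HasLaw ω (multivariateGaussian 0 (K.D S - S)) P')
    (hbω : IndepFun b ω P') :
    P'.map (fun o => K.rejectionSet α (b o) S (ω o))
      = (P'.prod (stdGaussian (Vec d))).map
        (fun q => K.rejectionSet α (b q.1) S (mulV (K.M S) q.2)) := by
  have hR := K.measurable_rejectionSet hK α hS
  have hM := (measurable_mulV (K.M S)).aemeasurable (μ := stdGaussian (Vec d))
  have l := AEMeasurable.map_map_of_aemeasurable hR.aemeasurable (hb.prodMk hω.aemeasurable)
  have r := AEMeasurable.map_map_of_aemeasurable (μ := P'.prod (stdGaussian (Vec d)))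
    hR.aemeasurable (hb.comp_fst.prodMk ((measurable_mulV (K.M S)).comp measurable_snd).aemeasurable)
  refine l.symm.trans (Eq.trans ?_ r)
  congr 1
  rw [(indepFun_iff_map_prod_eq_prod_map_map hb hω.aemeasurable).1 hbω, hω.map_eq,
    multivariateGaussian_eq_map]
  simp only [zero_add]
  exact (map_prodMk_prod hb hM).symm

end Procedure
end Knockoff

theorem theorem4 {d : ℕ} (K : Knockoff.Procedure d) (hK : K.IsContinuous)
    (β : Knockoff.Vec d) (S : Knockoff.Mat d) (hS : S.PosDef)
    -- exact Gaussian sampling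
    {Ω' : Type*} [MeasurableSpace Ω'] (P' : Measure Ω') [IsProbabilityMeasure P']
    (b ω : Ω' → Knockoff.Vec d)
    (hb : HasLaw b (multivariateGaussian β S) P')
    (hω : HasLaw ω (multivariateGaussian 0 (K.D S - S)) P')
    (hbω : IndepFun b ω P')
    -- the estimators, and the standard normal noise generated by the analyst
    {Ω : ℕ → Type*} [∀ n, MeasurableSpace (Ω n)] (P : ∀ n, Measure (Ω n))
    [∀ n, IsProbabilityMeasure (P n)]
    (bhat : ∀ n, Ω n → Knockoff.Vec d) (Shat : ∀ n, Ω n → Knockoff.Mat d)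
    (noise : ∀ n, Ω n → Knockoff.Vec d)
    (hbhat : TendstoInDistribution bhat atTop b P P')
    (hShat_meas : ∀ n i j, AEMeasurable (fun o => Shat n o i j) (P n))
    (hShat_symm : ∀ n, ∀ᵐ o ∂(P n), (Shat n o).IsSymm)
    (hShat : Knockoff.TendstoInProbability P Shat S)
    (hnoise : ∀ n, HasLaw (noise n) (stdGaussian (Knockoff.Vec d)) (P n))
    (hindep : ∀ n, IndepFun
      (fun o => ((bhat n o, fun i j => Shat n o i j) : Knockoff.Vec d × (Fin d → Fin d → ℝ)))
      (noise n) (P n))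
    -- the complement of the good set is Lebesgue-null in the space that carries `(ξ, b + ω)`
    (hE : ((Knockoff.subspaceVolume (K.xiSpace S)).prod volume) (K.goodSetᶜ) = 0)
    (α : ℝ) :
    TendstoInDistribution
        (fun n o => K.rejectionSet α (bhat n o) (Shat n o)
          (Knockoff.mulV (K.M (Shat n o)) (noise n o)))
        atTop (fun o => K.rejectionSet α (b o) S (ω o)) P P' ∧
      Tendsto
        (fun n => ∫ o, Knockoff.fdp β (K.rejectionSet α (bhat n o) (Shat n o)
          (Knockoff.mulV (K.M (Shat n o)) (noise n o))) ∂(P n))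
        atTop (𝓝 (∫ o, Knockoff.fdp β (K.rejectionSet α (b o) S (ω o)) ∂P')) ∧
      ((∃ j, β j ≠ 0) → Tendsto
        (fun n => ∫ o, Knockoff.tpp β (K.rejectionSet α (bhat n o) (Shat n o)
          (Knockoff.mulV (K.M (Shat n o)) (noise n o))) ∂(P n))
        atTop (𝓝 (∫ o, Knockoff.tpp β (K.rejectionSet α (b o) S (ω o)) ∂P'))) := by
  have hmeas_limit : AEMeasurable (fun o => K.rejectionSet α (b o) S (ω o)) P' :=
    Measurable.comp_aemeasurable (f := fun o => (b o, ω o))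
      (K.measurable_rejectionSet hK α hS) (hb.aemeasurable.prodMk hω.aemeasurable)
  have hS_arr : ∀ n, AEMeasurable (fun o i j => Shat n o i j) (P n) := fun n =>
    aemeasurable_pi_lambda _ fun i => aemeasurable_pi_lambda _ fun j => hShat_meas n i j
  have h1 := Knockoff.tendstoInDistribution_prodMk_const hbhat
    (Y := fun n o i j => Shat n o i j) (c := fun i j => S i j) hS_arr hShat.tendsto_norm
  have h2 := Knockoff.tendstoInDistribution_prodMk_indep h1 hnoise hindep
  have hS_sym : Knockoff.symPart (fun i j => S i j) = S :=
    Knockoff.symPart_eq ((Matrix.conjTranspose_eq_transpose_of_trivial S).symm.trans hS.isHermitian)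
  have h3 := Knockoff.tendstoInDistribution_comp_of_ae_continuousAt h2
    (K.measurable_rejectionOf hK α) (by
      filter_upwards [K.ae_mem_goodSet hS hb hE] with q hq
      refine K.continuousAt_rejectionOf hK α ?_ ?_
      · simpa only [hS_sym] using hS
      · simpa only [Knockoff.Procedure.statsOf, Knockoff.Procedure.noiseOf, hS_sym] using hq)
  have hae : ∀ n, (fun o => K.rejectionSet α (bhat n o) (Shat n o)
      (Knockoff.mulV (K.M (Shat n o)) (noise n o))) =ᵐ[P n]
      fun o => K.rejectionOf α ((bhat n o, fun i j => Shat n o i j), noise n o) := fun n => by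
    filter_upwards [hShat_symm n] with o ho
    simp only [Knockoff.Procedure.rejectionOf, Knockoff.Procedure.noiseOf,
      Knockoff.symPart_eq ho]
  have main : TendstoInDistribution
      (fun n o => K.rejectionSet α (bhat n o) (Shat n o)
        (Knockoff.mulV (K.M (Shat n o)) (noise n o)))
      atTop (fun o => K.rejectionSet α (b o) S (ω o)) P P' := by
    refine Knockoff.tendstoInDistribution_of_map_eq h3
      (fun n => (h3.forall_aemeasurable n).congr (hae n).symm) hmeas_limit
      (fun n => Measure.map_congr (hae n)) ?_
    rw [K.map_rejectionSet_eq hK α hS hb.aemeasurable hω hbω]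
    simp only [Knockoff.Procedure.rejectionOf, Knockoff.Procedure.noiseOf, hS_sym]
  have hint : ∀ f : Finset (Fin d) → ℝ, Tendsto
      (fun n => ∫ o, f (K.rejectionSet α (bhat n o) (Shat n o)
        (Knockoff.mulV (K.M (Shat n o)) (noise n o))) ∂(P n))
      atTop (𝓝 (∫ o, f (K.rejectionSet α (b o) S (ω o)) ∂P')) := fun f =>
    Knockoff.tendsto_integral_of_tendstoInDistribution main
      (BoundedContinuousFunction.mkOfCompact ⟨f, continuous_of_discreteTopology⟩)
  exact ⟨main, hint _, fun _ => hint _⟩
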